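/- Let $F$ and $G$ be second countable locally compact (Hausdorff) groups with left Haar measures $\nu$ and $\mu$. Let $A(F)$ be the Fourier algebra of $F$, i.e. the set of functions $s\mapsto\langle\lambda_s\xi,\eta\rangle$ with $\xi,\eta\in L^2(F)$, where $(\lambda_s\xi)(t)=\xi(s^{-1}t)$, and let $B(G)$ be the Fourier–Stieltjes algebra of $G$, i.e. the set of functions $s\mapsto\langle\pi(s)\xi,\eta\rangle$ where $\pi$ is a (strongly continuous) unitary representation of $G$ on a Hilbert space $H$ and $\xi,\eta\in H$. For a left coset $C$ of a subgroup $K$ of $G$, a map $\beta:C\to F$ is called affine (resp. anti-affine) if there are a homomorphism (resp. anti-homomorphism) $\theta:K\to F$ and elements $s_0\in F$, $t_0\in G$ such that $C=t_0^{-1}K$ and $\beta(t)=s_0\theta(t_0t)$ for all $t\in C$. The open coset ring $\Omega_0(G)$ is the smallest ring of subsets of $G$ containing the cosets of the open subgroups of $G$. Let $Y\subseteq G$ be clopen, and let $\alpha:Y\to F$ be a mixed piecewise affine map: there are finitely many pairwise disjoint clopen sets $Y_1,\dots,Y_m\in\Omega_0(G)$ with $Y=\bigcup_{i=1}^m Y_i$,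 open cosets $C_i\supseteq Y_i$ of $G$, and continuous maps $\alpha_i:C_i\to F$, each of them affine or anti-affine, such that $\alpha|_{Y_i}=\alpha_i|_{Y_i}$ for all $i$. For $u:F\to\mathbb{C}$ let $\phi_\alpha(u):G\to\mathbb{C}$ be the function equal to $u(\alpha(t))$ for $t\in Y$ and to $0$ for $t\in G\setminus Y$. Then $\phi_\alpha$ maps $A(F)$ into $B(G)$, and the following are equivalent: 1. The map $\phi_\alpha:A(F)\to B(G)$ extends to a bounded $w^*$-continuous algebra homomorphism $L^\infty(F,\nu)\to L^\infty(G,\mu)$, where $L^\infty$ carries the weak-* topology as the dual of $L^1$ (and the elements of $A(F)$ and their images under $\phi_\alpha$ are identified with their classes in $L^\infty$). 2. $\alpha$ is an open map. -/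

import Mathlib

open MeasureTheory Topology
open scoped ENNReal Pointwise

universe u v w

noncomputable section

/-- The Fourier algebra `A(F)`, as a set of functions on `F`: the coefficient functions
`s ↦ ⟨λ_s ξ, η⟩` of the left regular representation `(λ_s ξ)(t) = ξ(s⁻¹ t)` on `L²(F, ν)`, where `ν`
is a left Haar measure. (`DomMulAct.mk s⁻¹ • ξ` is the class of `t ↦ ξ (s⁻¹ * t)`; the inner product
`inner ℂ x y` of Mathlib is linear in `y`.) -/
def fourierAlgebra {F : Type u} [Group F] [MeasurableSpace F] [MeasurableMul F]
    (ν : Measure F) [ν.IsMulLeftInvariant] : Set (F → ℂ) :=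
  {φ | ∃ ξ η : Lp ℂ 2 ν, ∀ s : F, φ s = inner ℂ η (DomMulAct.mk s⁻¹ • ξ)}

/-- The Fourier–Stieltjes algebra `B(G)`, as a set of functions on `G`: the coefficient functions
`s ↦ ⟨π(s) ξ, η⟩` of the (strongly continuous) unitary representations `π` of `G` on complex Hilbert
spaces. -/
def fourierStieltjesAlgebra (G : Type v) [Group G] [TopologicalSpace G] : Set (G → ℂ) :=
  {φ | ∃ (H : Type w) (_ : NormedAddCommGroup H) (_ : InnerProductSpace ℂ H) (_ : CompleteSpace H)
    (π : G →* unitary (H →L[ℂ] H)) (ξ η : H),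
    (∀ x : H, Continuous fun s : G => (π s : H →L[ℂ] H) x) ∧
    ∀ s : G, φ s = inner ℂ η ((π s : H →L[ℂ] H) ξ)}

/-- The open cosets of `G`: the left cosets of the open subgroups of `G`. (The right coset `K x` is
the left coset `x (x⁻¹ K x)`, so these are also the right cosets of the open subgroups.) -/
def IsOpenCoset {G : Type v} [Group G] [TopologicalSpace G] (C : Set G) : Prop :=
  ∃ (K : Subgroup G) (t : G), IsOpen (K : Set G) ∧ C = t • (K : Set G)

/-- The open coset ring `Ω₀(G)`: the smallest ring of subsets of `G` containing the open cosets. -/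
def openCosetRing (G : Type v) [Group G] [TopologicalSpace G] : Set (Set G) :=
  ⋂₀ {R | IsSetRing R ∧ ∀ C : Set G, IsOpenCoset C → C ∈ R}

/-- `α : C → F` is affine: there are a subgroup `K`, a homomorphism `θ : K → F`, and elements
`s₀ ∈ F`, `t₀ ∈ G` such that `C = t₀⁻¹ K` and `α t = s₀ θ(t₀ t)` for all `t ∈ C`. -/
def IsAffineMap {G : Type v} {F : Type u} [Group G] [Group F] {C : Set G} (α : C → F) : Prop :=
  ∃ (K : Subgroup G) (θ : K → F) (s₀ : F) (t₀ : G),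
    (∀ x y : K, θ (x * y) = θ x * θ y) ∧
    C = t₀⁻¹ • (K : Set G) ∧
    ∀ (t : C) (k : K), (k : G) = t₀ * t → α t = s₀ * θ k

/-- `α : C → F` is anti-affine: as for affine maps, with an anti-homomorphism `θ`. -/
def IsAntiAffineMap {G : Type v} {F : Type u} [Group G] [Group F] {C : Set G} (α : C → F) : Prop :=
  ∃ (K : Subgroup G) (θ : K → F) (s₀ : F) (t₀ : G),
    (∀ x y : K, θ (x * y) = θ y * θ x) ∧
    C = t₀⁻¹ • (K : Set G) ∧
    ∀ (t : C) (k : K), (k : G) = t₀ * t → α t = s₀ * θ k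

/-- `α : Y → F` is mixed piecewise affine: `Y` is a finite disjoint union of clopen sets `Y i` in
the open coset ring of `G`, each contained in an open coset `C i`, and on `Y i` the map `α` agrees
with a continuous affine or anti-affine map `C i → F`. -/
def IsMixedPiecewiseAffine {G : Type v} {F : Type u} [Group G] [TopologicalSpace G]
    [Group F] [TopologicalSpace F] {Y : Set G} (α : Y → F) : Prop :=
  ∃ (m : ℕ) (Yi : Fin m → Set G) (Ci : Fin m → Set G) (αi : ∀ i, Ci i → F),
    Pairwise (fun i j => Disjoint (Yi i) (Yi j)) ∧
    Y = ⋃ i, Yi i ∧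
    ∀ i, IsClopen (Yi i) ∧ Yi i ∈ openCosetRing G ∧
      IsOpenCoset (Ci i) ∧ Yi i ⊆ Ci i ∧
      Continuous (αi i) ∧ (IsAffineMap (αi i) ∨ IsAntiAffineMap (αi i)) ∧
      ∀ (t : G) (hY : t ∈ Y) (hC : t ∈ Ci i), t ∈ Yi i → α ⟨t, hY⟩ = αi i ⟨t, hC⟩

open Classical in
/-- `φ_α(u) = χ_Y · (u ∘ α)`: the function equal to `u (α t)` for `t ∈ Y` and to `0` off `Y`. -/
def phiMap {G : Type v} {F : Type u} {Y : Set G} (α : Y → F) (φ : F → ℂ) : G → ℂ :=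
  fun t => if h : t ∈ Y then φ (α ⟨t, h⟩) else 0

/-- The weak-* topology on `L^∞(X, μ)` as the dual of `L¹(X, μ)`: the coarsest topology for which
`f ↦ ∫ f g dμ` is continuous for every `g ∈ L¹(X, μ)`. -/
abbrev weakStarTopology {X : Type u} [MeasurableSpace X] (μ : Measure X) :
    TopologicalSpace (Lp ℂ ∞ μ) :=
  ⨅ g : Lp ℂ 1 μ, TopologicalSpace.induced (fun f : Lp ℂ ∞ μ => ∫ x, f x * g x ∂μ) inferInstance

/-- The pointwise (a.e.) product on `L^∞(X, μ)`. -/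
def linftyMul {X : Type u} [MeasurableSpace X] {μ : Measure X} (f g : Lp ℂ ∞ μ) : Lp ℂ ∞ μ :=
  ((Lp.memLp g).mul (Lp.memLp f) : MemLp ((f : X → ℂ) * (g : X → ℂ)) ∞ μ).toLp _

/-- `Φ : L^∞(F) → L^∞(G)` is multiplicative, hence (being linear) an algebra homomorphism. -/
def IsMultiplicative {F : Type u} {G : Type v} [MeasurableSpace F] [MeasurableSpace G]
    {ν : Measure F} {μ : Measure G} (Φ : Lp ℂ ∞ ν →L[ℂ] Lp ℂ ∞ μ) : Prop :=
  ∀ f g : Lp ℂ ∞ ν, Φ (linftyMul f g) = linftyMul (Φ f) (Φ g)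

/-- `Φ` extends `φ_α`: each `u ∈ A(F)` is in `L^∞(F)`, and `Φ` sends its class to that of
`φ_α(u)`. -/
def ExtendsPhi {F : Type u} {G : Type v} [Group F] [MeasurableSpace F] [MeasurableMul F]
    [MeasurableSpace G] (ν : Measure F) [ν.IsMulLeftInvariant] (μ : Measure G) {Y : Set G}
    (α : Y → F) (Φ : Lp ℂ ∞ ν →L[ℂ] Lp ℂ ∞ μ) : Prop :=
  ∀ φ ∈ fourierAlgebra ν, ∃ f : Lp ℂ ∞ ν, f =ᵐ[ν] φ ∧ Φ f =ᵐ[μ] phiMap α φ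

end

/-!
The proof rests on a common form for affine and anti-affine maps: composing an anti-homomorphism with
the inversion of `F` gives a homomorphism, so both kinds of map are `t ↦ e (θ (t₀ t))` with `θ` a
continuous homomorphism on an open subgroup `K` and `e` a translation of `F`, possibly preceded by
the inversion (`exists_hasAffineForm`). Such an `e` preserves `A(F)` and the null sets of `F`.

*`φ_α` maps `A(F)` into `B(G)`.* For `φ ∈ A(F)`, the function `φ ∘ e ∘ θ` is a coefficient of the
representation `λ ∘ θ` of `K`. A coefficient of a representation of an open subgroup, extended by
zero, is a coefficient of the induced representation
(`extend_by_zero_mem_fourierStieltjesAlgebra`). The indicator of a set in the open coset ring is a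
linear combination of indicators of open cosets (`indicator_mem_span_of_mem_openCosetRing`), and
cutting down to a coset amounts to passing to a smaller open subgroup
(`indicator_coset_mul_coefficient_mem`).

*Open implies extendable.* If `α` is open, each `θ` that occurs has range of positive measure, and
Fubini's theorem shows that `θ` pulls null sets back to null sets (`measure_preimage_hom_eq_zero`).
Hence `a ↦ χ_Y · (a ∘ α)` is well defined on `L^∞(F)`; by the Radon-Nikodym theorem it is the adjoint
of a map `L¹(G) → L¹(F)` (`exists_density`), so it is weak-* continuous.

*Extendable implies open.* For a compact set `B ⊆ Y` there are `u n ∈ A(F)`, bounded by `1` and equal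
to `1` on `α(B)`, that tend to the indicator of `α(B)` pointwise. If `α(B)` is null, they tend to `0`
weak-*, while `φ_α (u n) = 1` on `B`; so `B` is null (`measure_eq_zero_of_measure_image_eq_zero`).
Therefore `θ(P)` has positive measure for each compact neighbourhood `P` of `1`, and Steinhaus'
theorem makes `θ(P / P)` a neighbourhood of `1` (`IsMixedPiecewiseAffine.isOpenMap`).
-/

/-! ### The Fourier-Stieltjes algebra -/

section Coefficients

variable {G : Type v} [Group G] [TopologicalSpace G]

/-- A strongly continuous action by linear isometries has its coefficients in `B(G)`: an isometric
action of a group is unitary. -/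
theorem coefficient_mem_fourierStieltjesAlgebra {H : Type w} [NormedAddCommGroup H]
    [InnerProductSpace ℂ H] [CompleteSpace H] (T : G →* (H →L[ℂ] H))
    (hT : ∀ g x, ‖T g x‖ = ‖x‖) (hc : ∀ x, Continuous fun s => T s x) (ξ η : H) :
    (fun s => inner ℂ η (T s ξ)) ∈ fourierStieltjesAlgebra.{v, w} G := by
  have h1 : ∀ g, star (T g) * T g = 1 := fun g =>
    (ContinuousLinearMap.norm_map_iff_adjoint_comp_self (T g)).1 (hT g)
  have h2 : ∀ g, T g * star (T g) = 1 := fun g => by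
    have h3 : T g * T g⁻¹ = 1 := by rw [← map_mul]; simp
    have h4 : star (T g) = T g⁻¹ := by
      calc star (T g) = star (T g) * (T g * T g⁻¹) := by rw [h3, mul_one]
        _ = T g⁻¹ := by rw [← mul_assoc, h1, one_mul]
    rw [h4, h3]
  exact ⟨H, inferInstance, inferInstance, inferInstance,
    T.codRestrict (unitary (H →L[ℂ] H)) fun g => Unitary.mem_iff.2 ⟨h1 g, h2 g⟩, ξ, η, hc,
    fun _ => rfl⟩

theorem fourierStieltjesAlgebra.smul_mem {φ : G → ℂ} (hφ : φ ∈ fourierStieltjesAlgebra.{v, w} G)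
    (c : ℂ) : c • φ ∈ fourierStieltjesAlgebra.{v, w} G := by
  obtain ⟨H, _, _, _, π, ξ, η, hc, h⟩ := hφ
  exact ⟨H, inferInstance, inferInstance, inferInstance, π, c • ξ, η, hc,
    fun s => by simp [h]⟩

theorem fourierStieltjesAlgebra.add_mem {φ ψ : G → ℂ} (hφ : φ ∈ fourierStieltjesAlgebra.{v, w} G)
    (hψ : ψ ∈ fourierStieltjesAlgebra.{v, w} G) : φ + ψ ∈ fourierStieltjesAlgebra.{v, w} G := by
  obtain ⟨H, _, _, _, π, ξ, η, hc, h⟩ := hφ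
  obtain ⟨H', _, _, _, π', ξ', η', hc', h'⟩ := hψ
  have hn : ∀ (g : G) (x : H), ‖(π g : H →L[ℂ] H) x‖ = ‖x‖ := fun g x =>
    ContinuousLinearMap.norm_map_of_mem_unitary (π g).2 x
  have hn' : ∀ (g : G) (x : H'), ‖(π' g : H' →L[ℂ] H') x‖ = ‖x‖ := fun g x =>
    ContinuousLinearMap.norm_map_of_mem_unitary (π' g).2 x
  let e := WithLp.prodContinuousLinearEquiv 2 ℂ H H'
  let T : G →* (WithLp 2 (H × H') →L[ℂ] WithLp 2 (H × H')) :=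
    { toFun := fun g => (e.symm : H × H' →L[ℂ] WithLp 2 (H × H')) ∘L
        ((π g : H →L[ℂ] H).prodMap (π' g : H' →L[ℂ] H')) ∘L (e : WithLp 2 (H × H') →L[ℂ] H × H')
      map_one' := by ext x; simp [e]
      map_mul' := fun a b => by ext x; simp [e]; rfl }
  have hT : ∀ g x, T g x = WithLp.toLp 2 ((π g : H →L[ℂ] H) x.fst, (π' g : H' →L[ℂ] H') x.snd) :=
    fun g x => rfl
  have key := coefficient_mem_fourierStieltjesAlgebra T
    (fun g x => by rw [hT, WithLp.prod_norm_eq_of_L2, WithLp.prod_norm_eq_of_L2]; simp [hn, hn'])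
    (fun x => by
      simp only [hT]
      exact (WithLp.prod_continuous_toLp 2 H H').comp ((hc _).prodMk (hc' _)))
    (WithLp.toLp 2 (ξ, ξ')) (WithLp.toLp 2 (η, η'))
  convert key using 1
  ext s
  simp [hT, h, h', WithLp.prod_inner_apply]

theorem fourierStieltjesAlgebra.zero_mem : (0 : G → ℂ) ∈ fourierStieltjesAlgebra.{v, w} G :=
  ⟨PUnit, inferInstance, inferInstance, inferInstance, 1, 0, 0, fun _ => continuous_const,
    fun _ => by simp⟩

theorem fourierStieltjesAlgebra.comp_mul_left_mem {φ : G → ℂ}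
    (hφ : φ ∈ fourierStieltjesAlgebra.{v, w} G) (b : G) :
    (fun t => φ (b * t)) ∈ fourierStieltjesAlgebra.{v, w} G := by
  obtain ⟨H, _, _, _, π, ξ, η, hc, h⟩ := hφ
  refine ⟨H, inferInstance, inferInstance, inferInstance, π, ξ,
    ContinuousLinearMap.adjoint (π b : H →L[ℂ] H) η, hc, fun s => ?_⟩
  simp [h, ContinuousLinearMap.adjoint_inner_left]

/-- `B(G)` as a subspace of the space of functions on `G`. -/
def fourierStieltjesSubmodule (G : Type v) [Group G] [TopologicalSpace G] :
    Submodule ℂ (G → ℂ) where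
  carrier := fourierStieltjesAlgebra.{v, w} G
  add_mem' := fourierStieltjesAlgebra.add_mem
  zero_mem' := fourierStieltjesAlgebra.zero_mem
  smul_mem' c _ h := fourierStieltjesAlgebra.smul_mem h c

end Coefficients

/-! ### Representations induced from open subgroups -/

noncomputable section Induced

variable {G : Type v} [Group G] (K : Subgroup G)

/-- The cocycle `(g, y) ↦ s(g y)⁻¹ g s(y) ∈ K` of the section `s = Quotient.out` of `G → G ⧸ K`. -/
def cosetCocycle (g : G) (y : G ⧸ K) : K :=
  ⟨(g • y).out⁻¹ * (g * y.out), by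
    rw [← QuotientGroup.eq, QuotientGroup.out_eq', ← smul_eq_mul, ← MulAction.Quotient.smul_coe,
      QuotientGroup.out_eq']⟩

theorem cosetCocycle_one (y : G ⧸ K) : cosetCocycle K 1 y = 1 := by
  ext; simp [cosetCocycle]

theorem cosetCocycle_mul (g h : G) (y : G ⧸ K) :
    cosetCocycle K (g * h) y = cosetCocycle K g (h • y) * cosetCocycle K h y := by
  ext; simp [cosetCocycle, mul_assoc, mul_smul]

variable {K} {H : Type u} [NormedAddCommGroup H] [InnerProductSpace ℂ H]
  (ρ : K →* (H →L[ℂ] H))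

theorem hasSum_norm_cosetCocycle (hρ : ∀ k x, ‖ρ k x‖ = ‖x‖) (g : G) (f : lp (fun _ : G ⧸ K => H) 2) :
    HasSum (fun y => ‖ρ (cosetCocycle K g (g⁻¹ • y)) (f (g⁻¹ • y))‖ ^ (2 : ℝ≥0∞).toReal)
      (‖f‖ ^ (2 : ℝ≥0∞).toReal) := by
  simp only [hρ]
  exact (MulAction.toPerm g⁻¹ : Equiv.Perm (G ⧸ K)).hasSum_iff.2
    (lp.hasSum_norm (p := 2) (by norm_num) f)

variable (hρ : ∀ k x, ‖ρ k x‖ = ‖x‖)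

/-- The operator `(g f)(y) = ρ(σ(g, g⁻¹ y)) f(g⁻¹ y)` on `ℓ²(G ⧸ K, H)`, where `σ` is the cocycle of
a section. -/
def inducedIsometry (g : G) :
    lp (fun _ : G ⧸ K => H) 2 →ₗᵢ[ℂ] lp (fun _ : G ⧸ K => H) 2 where
  toFun f := ⟨fun y => ρ (cosetCocycle K g (g⁻¹ • y)) (f (g⁻¹ • y)),
    memℓp_gen (hasSum_norm_cosetCocycle ρ hρ g f).summable⟩
  map_add' f f' := by ext y; simp; rfl
  map_smul' c f := by ext y; simp
  norm_map' f := (Real.rpow_left_inj (norm_nonneg _) (norm_nonneg _) (by norm_num)).1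
    ((lp.hasSum_norm (p := 2) (by norm_num)
      (⟨fun y => ρ (cosetCocycle K g (g⁻¹ • y)) (f (g⁻¹ • y)),
        memℓp_gen (hasSum_norm_cosetCocycle ρ hρ g f).summable⟩ :
          lp (fun _ : G ⧸ K => H) 2)).unique (hasSum_norm_cosetCocycle ρ hρ g f))

/-- The representation of `G` induced from a representation `ρ` of the subgroup `K`, on
`ℓ²(G ⧸ K, H)`. -/
def inducedRep : G →* (lp (fun _ : G ⧸ K => H) 2 →L[ℂ] lp (fun _ : G ⧸ K => H) 2) where
  toFun g := (inducedIsometry ρ hρ g).toContinuousLinearMap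
  map_one' := by
    ext f y
    simp [inducedIsometry, cosetCocycle_one]
  map_mul' g h := by
    ext f y
    simp [inducedIsometry, cosetCocycle_mul, mul_smul]

theorem inducedRep_apply (g : G) (f : lp (fun _ : G ⧸ K => H) 2) (y : G ⧸ K) :
    inducedRep ρ hρ g f y = ρ (cosetCocycle K g (g⁻¹ • y)) (f (g⁻¹ • y)) := rfl

theorem norm_inducedRep (g : G) (f : lp (fun _ : G ⧸ K => H) 2) :
    ‖inducedRep ρ hρ g f‖ = ‖f‖ :=
  (inducedIsometry ρ hρ g).norm_map f

open Classical in
theorem inducedRep_single (g : G) (y : G ⧸ K) (x : H) :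
    inducedRep ρ hρ g (lp.single 2 y x) = lp.single 2 (g • y) (ρ (cosetCocycle K g y) x) := by
  ext z
  rw [inducedRep_apply]
  by_cases hz : z = g • y
  · subst hz
    simp
  · have hz' : g⁻¹ • z ≠ y := fun h => hz (by rw [← h]; simp)
    rw [lp.single_apply_ne _ _ _ hz, lp.single_apply_ne _ _ _ hz', map_zero]

/-- The induced representation is strongly continuous when `K` is open. It suffices to look at the
orbit maps of the finitely supported vectors at the identity; the vectors supported at `y` are
moved inside the fibre over `y` by the elements of the open stabilizer of `y`. -/
theorem continuous_inducedRep [TopologicalSpace G] [IsTopologicalGroup G]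
    (hK : IsOpen (K : Set G)) (hc : ∀ x, Continuous fun k => ρ k x)
    (f : lp (fun _ : G ⧸ K => H) 2) : Continuous fun g => inducedRep ρ hρ g f := by
  classical
  have hsingle : ∀ (y : G ⧸ K) (x : H),
      ContinuousAt (fun g => inducedRep ρ hρ g (lp.single 2 y x)) 1 := by
    intro y x
    let U : Set G := {g | y.out⁻¹ * (g * y.out) ∈ K}
    have hU : IsOpen U := hK.preimage (by fun_prop)
    have h1 : (1 : G) ∈ U := by simp [U, K.one_mem]
    have hfix : ∀ g ∈ U, g • y = y := fun g hg => by
      have h2 := QuotientGroup.eq.2 (show y.out⁻¹ * (g * y.out) ∈ K from hg)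
      rw [QuotientGroup.out_eq', ← smul_eq_mul, ← MulAction.Quotient.smul_coe,
        QuotientGroup.out_eq'] at h2
      exact h2.symm
    rw [show (1 : G) = ((⟨1, h1⟩ : U) : G) from rfl,
      ← hU.isOpenEmbedding_subtypeVal.continuousAt_iff]
    refine Continuous.continuousAt ?_
    have heq : ((fun g => inducedRep ρ hρ g (lp.single 2 y x)) ∘ ((↑) : U → G)) = fun g : U =>
        lp.singleContinuousAddMonoidHom (fun _ => H) 2 y
          (ρ ⟨y.out⁻¹ * ((g : G) * y.out), g.2⟩ x) := by
      funext g
      have h3 : cosetCocycle K (g : G) y = ⟨y.out⁻¹ * ((g : G) * y.out), g.2⟩ := by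
        ext; simp [cosetCocycle, hfix g g.2]
      simp [inducedRep_single, hfix g g.2, h3]
    rw [heq]
    exact (map_continuous _).comp ((hc x).comp (by fun_prop))
  have hone : ∀ f, (ContinuousAt (fun g => inducedRep ρ hρ g f) 1) →
      Continuous fun g => inducedRep ρ hρ g f := by
    intro f hf
    refine continuous_iff_continuousAt.2 fun g₀ => ?_
    have h4 : (fun g => inducedRep ρ hρ g f) =
        fun g => inducedRep ρ hρ g₀ (inducedRep ρ hρ (g₀⁻¹ * g) f) := by
      funext g
      rw [← mul_apply_eq_comp, ← map_mul, mul_inv_cancel_left]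
    rw [h4]
    refine (map_continuous (inducedRep ρ hρ g₀)).continuousAt.comp ?_
    refine ContinuousAt.comp (f := fun g => g₀⁻¹ * g) (g := fun g => inducedRep ρ hρ g f) ?_
      (by fun_prop)
    simpa using hf
  refine continuous_of_uniform_approx_of_continuous fun u hu => ?_
  obtain ⟨ε, hε, hεu⟩ := Metric.mem_uniformity_dist.1 hu
  obtain ⟨s, hs⟩ := ((Metric.tendsto_nhds.1
    (lp.hasSum_single (p := 2) (by norm_num) f)) ε hε).exists
  refine ⟨fun g => inducedRep ρ hρ g (∑ i ∈ s, lp.single 2 i (f i)), ?_, fun g => hεu ?_⟩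
  · simp only [map_sum]
    exact continuous_finsetSum _ fun i _ => hone _ (hsingle i _)
  · rw [dist_eq_norm, ← map_sub, norm_inducedRep, ← dist_eq_norm, dist_comm]
    exact hs

open Classical in
/-- A coefficient of a unitary representation of an open subgroup, extended by `0`, is a coefficient
of the induced representation. -/
theorem extend_by_zero_mem_fourierStieltjesAlgebra [CompleteSpace H] [TopologicalSpace G]
    [IsTopologicalGroup G] (ρ : K →* (H →L[ℂ] H)) (hρ : ∀ k x, ‖ρ k x‖ = ‖x‖)
    (hK : IsOpen (K : Set G)) (hc : ∀ x, Continuous fun k => ρ k x) (ξ η : H) :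
    (fun g => if h : g ∈ K then inner ℂ η (ρ ⟨g, h⟩ ξ) else 0) ∈
      fourierStieltjesAlgebra.{v, max u v} G := by
  set y : G ⧸ K := ((1 : G) : G ⧸ K) with hy
  have hk : y.out ∈ K := by
    have := QuotientGroup.eq.1 ((QuotientGroup.out_eq' y).trans hy)
    simpa using this
  -- the section need not send the trivial coset to `1`, so both vectors are moved by `ρ (s y)⁻¹`
  set k : K := ⟨y.out, hk⟩
  have key := coefficient_mem_fourierStieltjesAlgebra (inducedRep ρ hρ) (norm_inducedRep ρ hρ)
    (continuous_inducedRep ρ hρ hK hc) (lp.single 2 y (ρ k⁻¹ ξ)) (lp.single 2 y (ρ k⁻¹ η))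
  convert key using 1
  funext g
  rw [inducedRep_single, lp.inner_single_left]
  have hgy : g • y = y ↔ g ∈ K := by
    rw [hy, MulAction.Quotient.smul_coe, smul_eq_mul, mul_one, eq_comm, QuotientGroup.eq]
    simp
  by_cases hg : g ∈ K
  · have hfix := hgy.2 hg
    have hcoc : cosetCocycle K g y = k⁻¹ * (⟨g, hg⟩ * k) := by
      ext; simp [cosetCocycle, hfix, k]
    have hinner : ∀ a b, inner ℂ (ρ k⁻¹ a) (ρ k⁻¹ b) = inner ℂ a b := 
      (LinearMap.norm_map_iff_inner_map_map (ρ k⁻¹)).1 (hρ k⁻¹)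
    rw [dif_pos hg, hfix, lp.single_apply_self, hcoc, ← mul_apply_eq_comp, ← map_mul,
      show k⁻¹ * (⟨g, hg⟩ * k) * k⁻¹ = k⁻¹ * ⟨g, hg⟩ by group, map_mul,
      mul_apply_eq_comp, hinner]
  · rw [dif_neg hg, lp.single_apply_ne _ _ _ (fun h => hg (hgy.1 h.symm)), inner_zero_right]

end Induced

/-! ### The open coset ring -/

section CosetRing

variable {G : Type v} [Group G]

theorem leftCoset_eq_smul_of_mem {C : Set G} {K : Subgroup G} {t x : G}
    (hC : C = t • (K : Set G)) (hx : x ∈ C) : C = x • (K : Set G) := by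
  subst hC
  rw [Set.mem_smul_set_iff_inv_smul_mem, smul_eq_mul] at hx
  exact (leftCoset_eq_iff K).2 hx

variable [TopologicalSpace G]

theorem IsOpenCoset.inter {C D : Set G} (hC : IsOpenCoset C) (hD : IsOpenCoset D)
    (h : (C ∩ D).Nonempty) : IsOpenCoset (C ∩ D) := by
  obtain ⟨K, t, hK, hCK⟩ := hC
  obtain ⟨L, s, hL, hDL⟩ := hD
  obtain ⟨x, hxC, hxD⟩ := h
  refine ⟨K ⊓ L, x, by simpa using hK.inter hL, ?_⟩
  rw [leftCoset_eq_smul_of_mem hCK hxC, leftCoset_eq_smul_of_mem hDL hxD, Subgroup.coe_inf, Set.smul_set_inter]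

/-- As the intersection of two open cosets is empty or an open coset, the indicators of open cosets
span an algebra; hence the indicator of a set in the open coset ring lies in their span. -/
theorem indicator_mem_span_of_mem_openCosetRing {A : Set G} (hA : A ∈ openCosetRing G) :
    A.indicator (1 : G → ℂ) ∈
      Submodule.span ℂ {f : G → ℂ | ∃ C, IsOpenCoset C ∧ f = C.indicator 1} := by
  set S := {f : G → ℂ | ∃ C, IsOpenCoset C ∧ f = C.indicator 1}
  have hmul : ∀ f g : G → ℂ, f ∈ Submodule.span ℂ S → g ∈ Submodule.span ℂ S →
      f * g ∈ Submodule.span ℂ S := by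
    intro f g hf hg
    have h := Submodule.mul_mem_mul hf hg
    rw [Submodule.span_mul_span] at h
    refine Submodule.span_le.2 ?_ h
    rintro _ ⟨_, ⟨C, hC, rfl⟩, _, ⟨D, hD, rfl⟩, rfl⟩
    rw [SetLike.mem_coe]
    have h1 : (C.indicator (1 : G → ℂ)) * D.indicator 1 = (C ∩ D).indicator 1 := by
      rw [Set.inter_indicator_one]
    simp only [h1]
    rcases (C ∩ D).eq_empty_or_nonempty with h | h
    · rw [h, Set.indicator_empty]
      exact Submodule.zero_mem _
    · exact Submodule.subset_span ⟨_, hC.inter hD h, rfl⟩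
  refine hA {A | A.indicator (1 : G → ℂ) ∈ Submodule.span ℂ S} ⟨⟨?_, ?_, ?_⟩, fun C hC =>
    Submodule.subset_span ⟨C, hC, rfl⟩⟩
  · rw [Set.mem_ofPred_eq, Set.indicator_empty]
    exact Submodule.zero_mem _
  · intro A B hA hB
    have : (A ∪ B).indicator (1 : G → ℂ) = A.indicator 1 + B.indicator 1 -
        A.indicator 1 * B.indicator 1 := by
      funext x; by_cases h1 : x ∈ A <;> by_cases h2 : x ∈ B <;> simp [h1, h2]
    simpa only [Set.mem_ofPred_eq, this] using
      Submodule.sub_mem _ (Submodule.add_mem _ hA hB) (hmul _ _ hA hB)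
  · intro A B hA hB
    have : (A \ B).indicator (1 : G → ℂ) = A.indicator 1 - A.indicator 1 * B.indicator 1 := by
      funext x; by_cases h1 : x ∈ A <;> by_cases h2 : x ∈ B <;> simp [h1, h2]
    simpa only [Set.mem_ofPred_eq, this] using Submodule.sub_mem _ hA (hmul _ _ hA hB)

variable [IsTopologicalGroup G] {K : Subgroup G} {H : Type u} [NormedAddCommGroup H]
  [InnerProductSpace ℂ H] [CompleteSpace H]

open Classical in
/-- A coefficient of a representation of `K`, cut down to the open coset `C` and extended by `0`, is
in `B(G)`: up to a translation it is a coefficient of the open subgroup `K ⊓ L`, where `C` is a coset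
of `L`. -/
theorem indicator_coset_mul_coefficient_mem (hK : IsOpen (K : Set G)) (ρ : K →* (H →L[ℂ] H))
    (hρ : ∀ k x, ‖ρ k x‖ = ‖x‖) (hc : ∀ x, Continuous fun k => ρ k x) (ξ η : H) {C : Set G}
    (hC : IsOpenCoset C) :
    C.indicator 1 * (fun g => if h : g ∈ K then inner ℂ η (ρ ⟨g, h⟩ ξ) else 0) ∈
      fourierStieltjesAlgebra.{v, max u v} G := by
  obtain ⟨L, t, hL, hCL⟩ := hC
  by_cases hne : ∃ a, a ∈ C ∧ a ∈ K
  · obtain ⟨a, haC, haK⟩ := hne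
    have hCa := leftCoset_eq_smul_of_mem hCL haC
    let i : (K ⊓ L : Subgroup G) →* K := Subgroup.inclusion inf_le_left
    have hi : Continuous i := continuous_subtype_val.subtype_mk _
    have key := extend_by_zero_mem_fourierStieltjesAlgebra (ρ.comp i) (fun k x => hρ _ x)
      (by simpa using hK.inter hL) (fun x => (hc x).comp hi) ξ
      (ContinuousLinearMap.adjoint (ρ ⟨a, haK⟩) η)
    convert fourierStieltjesAlgebra.comp_mul_left_mem key a⁻¹ using 1
    funext g
    have hgC : g ∈ C ↔ a⁻¹ * g ∈ L := by
      rw [hCa, Set.mem_smul_set_iff_inv_smul_mem, smul_eq_mul, SetLike.mem_coe]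
    have hgK : g ∈ K ↔ a⁻¹ * g ∈ K := (K.mul_mem_cancel_left (K.inv_mem haK)).symm
    by_cases h1 : g ∈ C <;> by_cases h2 : g ∈ K
    · have h3 : a⁻¹ * g ∈ K ⊓ L := ⟨hgK.1 h2, hgC.1 h1⟩
      have h4 : (⟨g, h2⟩ : K) = ⟨a, haK⟩ * i ⟨a⁻¹ * g, h3⟩ := by ext; simp [i]
      simp only [Pi.mul_apply, Set.indicator_of_mem h1, dif_pos h2, dif_pos h3, h4, map_mul]
      simp [ContinuousLinearMap.adjoint_inner_left]
    all_goals
      have h3 : ¬ a⁻¹ * g ∈ K ⊓ L := fun h => by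
        have := hgK.2 h.1
        have := hgC.2 h.2
        contradiction
      simp [h1, h2, h3, -Subgroup.mem_inf]
  · have : C.indicator 1 * (fun g => if h : g ∈ K then inner ℂ η (ρ ⟨g, h⟩ ξ) else 0) = 0 := by
      funext g
      by_cases h1 : g ∈ C
      · have h2 : g ∉ K := fun h => hne ⟨g, h1, h⟩
        simp [h2]
      · simp [h1]
    rw [this]
    exact fourierStieltjesAlgebra.zero_mem

end CosetRing

/-! ### The Fourier algebra -/

section FourierAlgebra

variable {F : Type u} [Group F] [TopologicalSpace F] [IsTopologicalGroup F] [MeasurableSpace F]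
  [BorelSpace F] (ν : Measure F) [ν.IsMulLeftInvariant]

/-- The left regular representation `(λ_s ξ)(t) = ξ(s⁻¹ t)` on `L²(F, ν)`. -/
noncomputable def leftRegularRep : F →* (Lp ℂ 2 ν →L[ℂ] Lp ℂ 2 ν) where
  toFun s := LinearMap.mkContinuous
    { toFun := fun ξ => DomMulAct.mk s⁻¹ • ξ
      map_add' := smul_add _
      map_smul' := fun c ξ => smul_comm _ _ _ } 1
    (fun ξ => by simp [DomMulAct.norm_smul_Lp])
  map_one' := by ext1 ξ; simp
  map_mul' s t := by ext1 ξ; simp [mul_smul]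

theorem leftRegularRep_apply (s : F) (ξ : Lp ℂ 2 ν) :
    leftRegularRep ν s ξ = DomMulAct.mk s⁻¹ • ξ := rfl

theorem norm_leftRegularRep (s : F) (ξ : Lp ℂ 2 ν) : ‖leftRegularRep ν s ξ‖ = ‖ξ‖ :=
  DomMulAct.norm_smul_Lp _ _

theorem continuous_leftRegularRep [T2Space F] [LocallyCompactSpace F] [SecondCountableTopology F]
    [IsFiniteMeasureOnCompacts ν] (ξ : Lp ℂ 2 ν) : Continuous fun s => leftRegularRep ν s ξ := by
  simp only [leftRegularRep_apply]
  have : Fact ((2 : ℝ≥0∞) ≠ ∞) := ⟨by simp⟩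
  exact ((DomMulAct.continuous_mk (M := F)).comp continuous_inv).smul continuous_const

variable {ν}

theorem mem_fourierAlgebra_iff {φ : F → ℂ} :
    φ ∈ fourierAlgebra ν ↔ ∃ ξ η : Lp ℂ 2 ν, ∀ s, φ s = inner ℂ η (leftRegularRep ν s ξ) :=
  Iff.rfl

theorem fourierAlgebra.comp_mul_left_mem {φ : F → ℂ} (hφ : φ ∈ fourierAlgebra ν) (a : F) :
    (fun s => φ (a * s)) ∈ fourierAlgebra ν := by
  obtain ⟨ξ, η, h⟩ := mem_fourierAlgebra_iff.1 hφ
  exact mem_fourierAlgebra_iff.2 ⟨ξ, ContinuousLinearMap.adjoint (leftRegularRep ν a) η,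
    fun s => by simp [h, ContinuousLinearMap.adjoint_inner_left]⟩

/-- `⟨λ_{s⁻¹} ξ, η⟩ = conj ⟨λ_s η, ξ⟩ = ⟨λ_s (conj η), conj ξ⟩`. -/
theorem fourierAlgebra.comp_inv_mem {φ : F → ℂ} (hφ : φ ∈ fourierAlgebra ν) :
    (fun s => φ s⁻¹) ∈ fourierAlgebra ν := by
  obtain ⟨ξ, η, h⟩ := mem_fourierAlgebra_iff.1 hφ
  refine mem_fourierAlgebra_iff.2 ⟨star η, star ξ, fun s => ?_⟩
  have h1 : φ s⁻¹ = inner ℂ (leftRegularRep ν s η) ξ := by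
    have := (LinearMap.norm_map_iff_inner_map_map (leftRegularRep ν s)).1
      (norm_leftRegularRep ν s) η (leftRegularRep ν s⁻¹ ξ)
    rw [h, ← this, ← mul_apply_eq_comp, ← map_mul]
    simp
  rw [h1, L2.inner_def, L2.inner_def]
  refine integral_congr_ae ?_
  have h2 : leftRegularRep ν s (star η) = star (leftRegularRep ν s η) := by
    rw [leftRegularRep_apply, leftRegularRep_apply]
    rcases η with ⟨⟨η⟩, _⟩
    rfl
  rw [h2]
  filter_upwards [Lp.coeFn_star ξ, Lp.coeFn_star (leftRegularRep ν s η)] with x h3 h4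
  simp [h3, h4]
  ring

end FourierAlgebra

/-! ### Affine and anti-affine maps -/

section NormalForm

variable {F : Type u} [Group F] [TopologicalSpace F] [IsTopologicalGroup F]
  {G : Type v} [Group G] [TopologicalSpace G] [IsTopologicalGroup G]

/-- The homeomorphism `e` of `F` is a left translation, or inversion followed by a left translation.
Composing a homomorphism with such a map gives both the affine and the anti-affine maps. -/
def IsSignedTranslation (e : F ≃ₜ F) : Prop :=
  (∃ s, ∀ x, e x = s * x) ∨ ∃ s, ∀ x, e x = s * x⁻¹

/-- `α : C → F` is `t ↦ e (θ (t₀ t))`, where `θ` is a continuous homomorphism on the open subgroup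
`K` and `C = t₀⁻¹ K`. -/
def HasAffineForm {C : Set G} (α : C → F) (K : Subgroup G) (θ : K →* F) (t₀ : G)
    (e : F ≃ₜ F) : Prop :=
  IsOpen (K : Set G) ∧ Continuous θ ∧ IsSignedTranslation e ∧ (∀ t, t ∈ C ↔ t₀ * t ∈ K) ∧
    ∀ (t : C) (k : K), (k : G) = t₀ * t → α t = e (θ k)

/-- A continuous affine or anti-affine map on an open coset is `e ∘ θ` up to a translation, for a
continuous homomorphism `θ`; in the anti-affine case the given anti-homomorphism is composed with
the inversion. -/
theorem exists_hasAffineForm {C : Set G} (hC : IsOpenCoset C) {α : C → F} (hα : Continuous α)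
    (h : IsAffineMap α ∨ IsAntiAffineMap α) :
    ∃ (K : Subgroup G) (θ : K →* F) (t₀ : G) (e : F ≃ₜ F), HasAffineForm α K θ t₀ e := by
  have hopen : ∀ {K : Subgroup G} {t₀ : G}, C = t₀⁻¹ • (K : Set G) → IsOpen (K : Set G) := by
    intro K t₀ hK
    obtain ⟨L, t, hL, hCL⟩ := hC
    have : (K : Set G) = t₀ • t • (L : Set G) := by rw [← hCL, hK, smul_inv_smul]
    rw [this]
    exact (hL.smul t).smul t₀
  have hmem : ∀ {K : Subgroup G} {t₀ : G}, C = t₀⁻¹ • (K : Set G) →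
      ∀ t, t ∈ C ↔ t₀ * t ∈ K := by
    rintro K t₀ rfl t
    rw [Set.mem_smul_set_iff_inv_smul_mem, inv_inv, smul_eq_mul, SetLike.mem_coe]
  have hcont : ∀ {K : Subgroup G} {t₀ : G} {θ : K → F} {s₀ : F}, C = t₀⁻¹ • (K : Set G) →
      (∀ (t : C) (k : K), (k : G) = t₀ * t → α t = s₀ * θ k) → Continuous θ := by
    intro K t₀ θ s₀ hK hθ
    have hk : ∀ k : K, t₀⁻¹ * (k : G) ∈ C := fun k => by
      rw [hmem hK, mul_inv_cancel_left]; exact k.2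
    have : θ = fun k : K => s₀⁻¹ * α ⟨t₀⁻¹ * (k : G), hk k⟩ := by
      funext k
      rw [hθ _ k (by simp), inv_mul_cancel_left]
    rw [this]
    fun_prop
  rcases h with ⟨K, θ, s₀, t₀, hmul, hK, hθ⟩ | ⟨K, θ, s₀, t₀, hmul, hK, hθ⟩
  · exact ⟨K, MonoidHom.mk' θ hmul, t₀, Homeomorph.mulLeft s₀, hopen hK, hcont hK hθ,
      Or.inl ⟨s₀, fun _ => rfl⟩, hmem hK, hθ⟩
  · exact ⟨K, MonoidHom.mk' (fun k => (θ k)⁻¹) (fun x y => by simp [hmul]), t₀,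
      (Homeomorph.inv F).trans (Homeomorph.mulLeft s₀), hopen hK, (hcont hK hθ).inv,
      Or.inr ⟨s₀, fun _ => rfl⟩, hmem hK, fun t k h => by simp [hθ t k h]⟩

theorem IsSignedTranslation.comp_mem_fourierAlgebra [MeasurableSpace F] [BorelSpace F]
    {ν : Measure F} [ν.IsMulLeftInvariant] {e : F ≃ₜ F} (he : IsSignedTranslation e) {φ : F → ℂ}
    (hφ : φ ∈ fourierAlgebra ν) : φ ∘ e ∈ fourierAlgebra ν := by
  rcases he with ⟨s, h⟩ | ⟨s, h⟩
  · rw [show φ ∘ e = fun x => φ (s * x) from funext fun x => by simp [h]]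
    exact fourierAlgebra.comp_mul_left_mem hφ s
  · rw [show φ ∘ e = fun x => φ (s * x⁻¹) from funext fun x => by simp [h]]
    exact fourierAlgebra.comp_inv_mem (fourierAlgebra.comp_mul_left_mem hφ s)

open Classical in
/-- `χ_A · (φ ∘ α) ∈ B(G)` for `φ ∈ A(F)`, `α` continuous and (anti-)affine and `A ∈ Ω₀(G)`. -/
theorem indicator_mul_comp_affine_mem [T2Space F] [LocallyCompactSpace F]
    [SecondCountableTopology F] [MeasurableSpace F] [BorelSpace F] {ν : Measure F}
    [ν.IsMulLeftInvariant] [IsFiniteMeasureOnCompacts ν] {C : Set G} {α : C → F}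
    {K : Subgroup G} {θ : K →* F} {t₀ : G} {e : F ≃ₜ F} (hα : HasAffineForm α K θ t₀ e)
    {φ : F → ℂ} (hφ : φ ∈ fourierAlgebra ν) {A : Set G} (hA : A ∈ openCosetRing G) :
    A.indicator 1 * (fun t => if h : t ∈ C then φ (α ⟨t, h⟩) else 0) ∈
      fourierStieltjesAlgebra.{v, max u v} G := by
  obtain ⟨hK, hθ, he, hC, hα⟩ := hα
  obtain ⟨ξ, η, hφ'⟩ := mem_fourierAlgebra_iff.1 (he.comp_mem_fourierAlgebra hφ)
  set f : G → ℂ := fun t => if h : t ∈ C then φ (α ⟨t, h⟩) else 0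
  suffices h : Submodule.span ℂ {f : G → ℂ | ∃ C, IsOpenCoset C ∧ f = C.indicator 1} ≤
      (fourierStieltjesSubmodule.{v, max u v} G).comap (LinearMap.mulRight ℂ f) from
    h (indicator_mem_span_of_mem_openCosetRing hA)
  refine Submodule.span_le.2 ?_
  rintro _ ⟨D, ⟨L, t, hL, rfl⟩, rfl⟩
  have key := indicator_coset_mul_coefficient_mem hK ((leftRegularRep ν).comp θ)
    (fun k x => norm_leftRegularRep ν _ x) (fun x => (continuous_leftRegularRep ν x).comp hθ) ξ η
    (C := (t₀ * t) • (L : Set G)) ⟨L, _, hL, rfl⟩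
  have key2 := fourierStieltjesAlgebra.comp_mul_left_mem key t₀
  change _ ∈ fourierStieltjesAlgebra.{v, max u v} G
  convert key2 using 1
  funext x
  have h1 : x ∈ t • (L : Set G) ↔ t₀ * x ∈ (t₀ * t) • (L : Set G) := by
    rw [mul_smul, ← smul_eq_mul t₀ x, Set.smul_mem_smul_set_iff]
  have h2 : (t • (L : Set G)).indicator (1 : G → ℂ) x =
      ((t₀ * t) • (L : Set G)).indicator 1 (t₀ * x) := by
    simp only [Set.indicator_apply, h1, Pi.one_apply]
  simp only [LinearMap.mulRight_apply, Pi.mul_apply, h2]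
  congr 1
  by_cases hx : x ∈ C
  · have hx' := (hC x).1 hx
    simp only [f, dif_pos hx, dif_pos hx']
    rw [hα ⟨x, hx⟩ ⟨_, hx'⟩ rfl]
    exact hφ' _
  · simp only [f, dif_neg hx, dif_neg (fun h => hx ((hC x).2 h))]

/-- `φ_α` maps `A(F)` into `B(G)`. -/
theorem phiMap_mem_fourierStieltjesAlgebra [T2Space F] [LocallyCompactSpace F]
    [SecondCountableTopology F] [MeasurableSpace F] [BorelSpace F] {ν : Measure F}
    [ν.IsMulLeftInvariant] [IsFiniteMeasureOnCompacts ν] {Y : Set G} {α : Y → F}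
    (hα : IsMixedPiecewiseAffine α) {φ : F → ℂ} (hφ : φ ∈ fourierAlgebra ν) :
    phiMap α φ ∈ fourierStieltjesAlgebra.{v, max u v} G := by
  classical
  obtain ⟨m, Yi, Ci, αi, hdisj, hY, h⟩ := hα
  have hsum : phiMap α φ = ∑ i, (Yi i).indicator 1 *
      fun t => if h : t ∈ Ci i then φ (αi i ⟨t, h⟩) else 0 := by
    funext t
    rw [Finset.sum_apply]
    by_cases ht : t ∈ Y
    · obtain ⟨i, hi⟩ := Set.mem_iUnion.1 (hY ▸ ht)
      have hC := (h i).2.2.2.1 hi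
      rw [Finset.sum_eq_single i]
      · simp [phiMap, ht, hi, hC, (h i).2.2.2.2.2.2 t ht hC hi]
      · intro j _ hj
        have : t ∉ Yi j := fun hj' => Set.disjoint_left.1 (hdisj hj) hj' hi
        simp [this]
      · simp
    · have : ∀ i, t ∉ Yi i := fun i hi => ht (hY ▸ Set.mem_iUnion.2 ⟨i, hi⟩)
      simp [phiMap, ht, this]
  rw [hsum]
  refine (fourierStieltjesSubmodule.{v, max u v} G).sum_mem fun i _ => ?_
  obtain ⟨-, hR, hC, -, hcont, haff, -⟩ := h i
  obtain ⟨K, θ, t₀, e, hform⟩ := exists_hasAffineForm hC hcont haff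
  exact indicator_mul_comp_affine_mem hform hφ hR

end NormalForm

/-! ### Preimages of null sets -/

section NullSets

variable {F : Type u} [Group F] [TopologicalSpace F] [IsTopologicalGroup F]
  [LocallyCompactSpace F] [SecondCountableTopology F] [MeasurableSpace F] [BorelSpace F]
  {G : Type v} [Group G] [TopologicalSpace G] [IsTopologicalGroup G]
  [LocallyCompactSpace G] [SecondCountableTopology G] [MeasurableSpace G] [BorelSpace G]
  {ν : Measure F} [ν.IsHaarMeasure] {μ : Measure G} [μ.IsHaarMeasure]

theorem IsSignedTranslation.measure_preimage_eq_zero_iff {e : F ≃ₜ F}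
    (he : IsSignedTranslation e) (N : Set F) : ν (e ⁻¹' N) = 0 ↔ ν N = 0 := by
  rcases he with ⟨s, h⟩ | ⟨s, h⟩
  · rw [show e ⁻¹' N = (fun x => s * x) ⁻¹' N by ext; simp [h], measure_preimage_mul]
  · rw [show e ⁻¹' N = ((fun x => s * x) ⁻¹' N)⁻¹ by ext; simp [h], measure_inv_null,
      measure_preimage_mul]

theorem IsSignedTranslation.measure_image_eq_zero_iff {e : F ≃ₜ F}
    (he : IsSignedTranslation e) (N : Set F) : ν (e '' N) = 0 ↔ ν N = 0 := by
  rw [← he.measure_preimage_eq_zero_iff, Set.preimage_image_eq _ e.injective]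

/-- A homomorphism whose range is not null pulls null sets back to null sets. The set
`{x | θ g * x ∈ N}` is null for every `g`, so by Fubini `{g | θ g * x ∈ N}` is null for almost all
`x`, hence for some `x = θ k`; a right translation by `k` then gives the claim. -/
theorem measure_preimage_hom_eq_zero {K : Subgroup G} (hK : IsOpen (K : Set G)) {θ : K →* F}
    (hθ : Continuous θ) (hr : ν (Set.range θ) ≠ 0) {N : Set F} (hN : MeasurableSet N)
    (hN0 : ν N = 0) : μ {g | ∃ h : g ∈ K, θ ⟨g, h⟩ ∈ N} = 0 := by
  classical
  let θ' : G → F := fun g => if h : g ∈ (K : Set G) then θ ⟨g, h⟩ else 1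
  have hθ' : Measurable θ' :=
    Measurable.dite (s := (K : Set G)) (f := θ) (g := fun _ => 1) hθ.measurable measurable_const
      hK.measurableSet
  let S : Set (F × G) := {p | p.2 ∈ (K : Set G) ∧ θ' p.2 * p.1 ∈ N}
  have hS : MeasurableSet S :=
    (measurable_snd hK.measurableSet).inter
      (((hθ'.comp measurable_snd).mul measurable_fst) hN)
  have hS0 : (ν.prod μ) S = 0 := by
    rw [Measure.prod_apply_symm hS, lintegral_eq_zero_iff (measurable_measure_prodMk_right hS)]
    refine Filter.Eventually.of_forall fun g => measure_mono_null (t := (fun x => θ' g * x) ⁻¹' N)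
      (fun x hx => hx.2) ?_
    rw [measure_preimage_mul, hN0]
  have hae := Measure.measure_ae_null_of_prod_null hS0
  obtain ⟨k, hk⟩ : ∃ k : K, μ (Prod.mk (θ k) ⁻¹' S) = 0 := by
    by_contra! hcon
    refine hr (measure_mono_null ?_ hae)
    rintro _ ⟨k, rfl⟩
    exact hcon k
  rw [← measure_mul_right_null μ (k : G)]
  refine measure_mono_null ?_ hk
  rintro g ⟨hg, hgN⟩
  have hgK : g ∈ K := (K.mul_mem_cancel_right k.2).1 hg
  refine ⟨hgK, ?_⟩
  have h1 : (⟨g * k, hg⟩ : K) = ⟨g, hgK⟩ * k := rfl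
  have h2 : θ' g = θ ⟨g, hgK⟩ := dif_pos hgK
  rw [h1, map_mul] at hgN
  simpa only [h2] using hgN

/-- On each of finitely many open sets covering `Y`, the map `α` has the form `t ↦ e (θ (t₀ t))`,
with `θ` a continuous homomorphism on an open subgroup and `e` a signed translation. -/
theorem IsMixedPiecewiseAffine.exists_cover {F : Type u} [Group F] [TopologicalSpace F]
    [IsTopologicalGroup F] {G : Type v} [Group G] [TopologicalSpace G] [IsTopologicalGroup G]
    {Y : Set G} {α : Y → F} (hα : IsMixedPiecewiseAffine α) :
    ∃ (m : ℕ) (A : Fin m → Set G), Y = ⋃ i, A i ∧ ∀ i, IsOpen (A i) ∧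
      ∃ (K : Subgroup G) (θ : K →* F) (t₀ : G) (e : F ≃ₜ F),
        IsOpen (K : Set G) ∧ Continuous θ ∧ IsSignedTranslation e ∧
        ∀ (t : G) (hY : t ∈ Y), t ∈ A i → ∃ hk : t₀ * t ∈ K, α ⟨t, hY⟩ = e (θ ⟨t₀ * t, hk⟩) := by
  obtain ⟨m, Yi, Ci, αi, -, hY, h⟩ := hα
  refine ⟨m, Yi, hY, fun i => ⟨(h i).1.isOpen, ?_⟩⟩
  obtain ⟨-, -, hC, hsub, hcont, haff, hag⟩ := h i
  obtain ⟨K, θ, t₀, e, hK, hθ, he, hmem, hform⟩ := exists_hasAffineForm hC hcont haff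
  refine ⟨K, θ, t₀, e, hK, hθ, he, fun t htY ht => ?_⟩
  have hk := (hmem t).1 (hsub ht)
  exact ⟨hk, (hag t htY (hsub ht) ht).trans (hform ⟨t, hsub ht⟩ ⟨_, hk⟩ rfl)⟩

theorem IsMixedPiecewiseAffine.continuous {F : Type u} [Group F] [TopologicalSpace F]
    [IsTopologicalGroup F] {G : Type v} [Group G] [TopologicalSpace G] [IsTopologicalGroup G]
    {Y : Set G} {α : Y → F} (hα : IsMixedPiecewiseAffine α) : Continuous α := by
  obtain ⟨m, A, hY, h⟩ := hα.exists_cover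
  refine continuous_iff_continuousAt.2 fun t => ?_
  obtain ⟨i, hi⟩ := Set.mem_iUnion.1 (hY ▸ t.2 : (t : G) ∈ ⋃ i, A i)
  obtain ⟨hA, K, θ, t₀, e, -, hθ, -, hform⟩ := h i
  have hU : IsOpen ((↑) ⁻¹' A i : Set Y) := hA.preimage continuous_subtype_val
  refine (hU.isOpenEmbedding_subtypeVal.continuousAt_iff (x := ⟨t, hi⟩)).1
    (Continuous.continuousAt ?_)
  have heq : α ∘ ((↑) : ((↑) ⁻¹' A i : Set Y) → Y) = fun x : ((↑) ⁻¹' A i : Set Y) =>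
      e (θ ⟨t₀ * ((x : Y) : G), (hform (x : Y) (x : Y).2 x.2).1⟩) :=
    funext fun x => (hform (x : Y) (x : Y).2 x.2).2
  rw [heq]
  fun_prop

/-- An open mixed piecewise affine map pulls null sets back to null sets. -/
theorem IsMixedPiecewiseAffine.measure_preimage_eq_zero {Y : Set G} {α : Y → F}
    (hα : IsMixedPiecewiseAffine α) (ho : IsOpenMap α) {N : Set F} (hN : MeasurableSet N)
    (hN0 : ν N = 0) : μ {t | ∃ h : t ∈ Y, α ⟨t, h⟩ ∈ N} = 0 := by
  obtain ⟨m, A, hY, h⟩ := hα.exists_cover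
  suffices H : ∀ i, μ {t | ∃ h : t ∈ Y, t ∈ A i ∧ α ⟨t, h⟩ ∈ N} = 0 by
    refine measure_mono_null ?_ (measure_iUnion_null H)
    rintro t ⟨ht, htN⟩
    obtain ⟨i, hi⟩ := Set.mem_iUnion.1 (hY ▸ ht)
    exact Set.mem_iUnion.2 ⟨i, ht, hi, htN⟩
  intro i
  obtain ⟨hA, K, θ, t₀, e, hK, hθ, he, hform⟩ := h i
  rcases (A i).eq_empty_or_nonempty with hempty | ⟨t, ht⟩
  · simp [hempty]
  have htY : t ∈ Y := hY ▸ Set.mem_iUnion.2 ⟨i, ht⟩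
  have hU : IsOpen (α '' ((↑) ⁻¹' A i)) := ho _ (hA.preimage continuous_subtype_val)
  have hr : ν (Set.range θ) ≠ 0 := by
    intro h0
    refine hU.measure_ne_zero ν ⟨_, ⟨t, htY⟩, ht, rfl⟩
      (measure_mono_null ?_ ((he.measure_image_eq_zero_iff (ν := ν) _).2 h0))
    rintro _ ⟨x, hx, rfl⟩
    obtain ⟨hk, hx'⟩ := hform x x.2 hx
    exact ⟨_, ⟨_, rfl⟩, hx'.symm⟩
  have key := measure_preimage_hom_eq_zero (μ := μ) hK hθ hr (e.continuous.measurable hN)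
    ((he.measure_preimage_eq_zero_iff (ν := ν) _).2 hN0)
  rw [← measure_preimage_mul μ t₀] at key
  refine measure_mono_null ?_ key
  rintro x ⟨hxY, hxA, hxN⟩
  obtain ⟨hk, hx'⟩ := hform x hxY hxA
  exact ⟨hk, by simpa [← hx'] using hxN⟩

end NullSets

/-! ### Weak-* continuous pullbacks on `L^∞` -/

noncomputable section Pullback

variable {X : Type u} {Z : Type v} [MeasurableSpace X] [MeasurableSpace Z] {ν : Measure X}
  {μ : Measure Z} {Y : Set Z} {f : Z → X}

theorem indicator_comp_ae_eq (hY : MeasurableSet Y)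
    (hf : Measure.QuasiMeasurePreserving f (μ.restrict Y) ν) {a b : X → ℂ} (hab : a =ᵐ[ν] b) :
    Y.indicator (a ∘ f) =ᵐ[μ] Y.indicator (b ∘ f) := by
  filter_upwards [(ae_restrict_iff' hY).1 (hf.ae_eq hab)] with x hx
  by_cases h : x ∈ Y
  · simpa [h] using hx h
  · simp [h]

theorem eLpNorm_indicator_comp_le (hY : MeasurableSet Y)
    (hf : Measure.QuasiMeasurePreserving f (μ.restrict Y) ν) {a : X → ℂ}
    (ha : AEStronglyMeasurable a ν) : eLpNorm (Y.indicator (a ∘ f)) ∞ μ ≤ eLpNorm a ∞ ν := by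
  rw [eLpNorm_indicator_eq_eLpNorm_restrict hY, ← eLpNorm_map_measure
    (ha.mono_ac hf.absolutelyContinuous) hf.measurable.aemeasurable, eLpNorm_exponent_top,
    eLpNorm_exponent_top]
  exact essSup_mono_measure hf.absolutelyContinuous

theorem memLp_indicator_comp (hY : MeasurableSet Y)
    (hf : Measure.QuasiMeasurePreserving f (μ.restrict Y) ν) {a : X → ℂ} (ha : MemLp a ∞ ν) :
    MemLp (Y.indicator (a ∘ f)) ∞ μ :=
  ⟨(aestronglyMeasurable_indicator_iff hY).2 (ha.1.comp_quasiMeasurePreserving hf),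
    (eLpNorm_indicator_comp_le hY hf ha.1).trans_lt ha.2⟩

/-- The map `a ↦ χ_Y · (a ∘ f)` from `L^∞(ν)` to `L^∞(μ)`, for `f` that pulls `ν`-null sets back to
`μ`-null subsets of `Y`. -/
def linftyPullback (hY : MeasurableSet Y)
    (hf : Measure.QuasiMeasurePreserving f (μ.restrict Y) ν) : Lp ℂ ∞ ν →L[ℂ] Lp ℂ ∞ μ :=
  LinearMap.mkContinuous
    { toFun := fun a => (memLp_indicator_comp hY hf (Lp.memLp a)).toLp _
      map_add' := fun a b => by
        rw [← MemLp.toLp_add]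
        refine MemLp.toLp_congr _ _ ((indicator_comp_ae_eq hY hf (Lp.coeFn_add a b)).trans ?_)
        rw [← Set.indicator_add']
        rfl
      map_smul' := fun c a => by
        rw [RingHom.id_apply, ← MemLp.toLp_const_smul]
        refine MemLp.toLp_congr _ _ ((indicator_comp_ae_eq hY hf (Lp.coeFn_smul c a)).trans ?_)
        exact Filter.EventuallyEq.of_eq (Set.indicator_const_smul Y c (a ∘ f)) } 1
    (fun a => by
      rw [one_mul, LinearMap.coe_mk, AddHom.coe_mk]
      refine (Lp.norm_toLp _ _).trans_le ?_
      exact ENNReal.toReal_mono (Lp.eLpNorm_ne_top a)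
        (eLpNorm_indicator_comp_le hY hf (Lp.aestronglyMeasurable a)))

theorem coeFn_linftyPullback (hY : MeasurableSet Y)
    (hf : Measure.QuasiMeasurePreserving f (μ.restrict Y) ν) (a : Lp ℂ ∞ ν) :
    linftyPullback hY hf a =ᵐ[μ] Y.indicator (a ∘ f) :=
  MemLp.coeFn_toLp (memLp_indicator_comp hY hf (Lp.memLp a))

theorem coeFn_linftyMul (a b : Lp ℂ ∞ ν) : linftyMul a b =ᵐ[ν] (a : X → ℂ) * (b : X → ℂ) :=
  MemLp.coeFn_toLp _

theorem isMultiplicative_linftyPullback (hY : MeasurableSet Y)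
    (hf : Measure.QuasiMeasurePreserving f (μ.restrict Y) ν) :
    IsMultiplicative (linftyPullback hY hf) := by
  intro a b
  refine Lp.ext ?_
  filter_upwards [coeFn_linftyPullback hY hf (linftyMul a b),
    indicator_comp_ae_eq hY hf (coeFn_linftyMul a b),
    coeFn_linftyMul (linftyPullback hY hf a) (linftyPullback hY hf b),
    coeFn_linftyPullback hY hf a, coeFn_linftyPullback hY hf b] with x h1 h2 h3 h4 h5
  rw [h1, h2, h3, Pi.mul_apply, h4, h5]
  by_cases h : x ∈ Y <;> simp [h]

theorem MeasureTheory.MemLp.integrable_top_mul {a g : X → ℂ} (ha : MemLp a ∞ ν)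
    (hg : Integrable g ν) : Integrable (fun x => a x * g x) ν := by
  refine memLp_one_iff_integrable.1 ?_
  exact (memLp_one_iff_integrable.2 hg).mul (p := ∞) (q := 1) ha

/-- The case of a nonnegative density in the construction of the preadjoint of `linftyPullback`: by
the Radon-Nikodym theorem the image under `f` of the finite measure `g dμ` has a density. -/
theorem exists_density_of_nonneg [SigmaFinite ν] {m : Measure Z}
    (hf : Measure.QuasiMeasurePreserving f m ν) {g : Z → ℝ} (hg : Integrable g m)
    (hg0 : 0 ≤ g) :
    ∃ h : X → ℂ, Integrable h ν ∧
      ∀ a : Lp ℂ ∞ ν, ∫ z, a (f z) * (g z : ℂ) ∂m = ∫ x, a x * h x ∂ν := by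
  set m' := m.withDensity fun z => ENNReal.ofReal (g z) with hm'
  have hfin : IsFiniteMeasure m' := isFiniteMeasure_withDensity_ofReal hg.2
  have hac : m'.map f ≪ ν :=
    ((withDensity_absolutelyContinuous m _).map hf.measurable).trans hf.absolutelyContinuous
  refine ⟨fun x => (((m'.map f).rnDeriv ν x).toReal : ℂ), Measure.integrable_toReal_rnDeriv.ofReal,
    fun a => ?_⟩
  have h1 := integral_rnDeriv_smul hac (f := a)
  have h2 := integral_withDensity_eq_integral_toReal_smul₀ (μ := m)
    hg.1.aemeasurable.ennreal_ofReal (by simp) (fun z => a (f z))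
  calc ∫ z, a (f z) * (g z : ℂ) ∂m = ∫ z, a (f z) ∂m' := by
        rw [hm', h2]
        refine integral_congr_ae (Filter.Eventually.of_forall fun z => ?_)
        simp [ENNReal.toReal_ofReal (hg0 z), mul_comm]
    _ = ∫ x, a x ∂(m'.map f) :=
        (integral_map hf.measurable.aemeasurable
          ((Lp.aestronglyMeasurable a).mono_ac hac)).symm
    _ = _ := by
        rw [← h1]
        refine integral_congr_ae (Filter.Eventually.of_forall fun z => ?_)
        simp [mul_comm]

/-- Integration of `a ∘ f` against an `L¹` function is integration of `a` against an `L¹` function. -/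
theorem exists_density [SigmaFinite ν] {m : Measure Z}
    (hf : Measure.QuasiMeasurePreserving f m ν) {g : Z → ℂ} (hg : Integrable g m) :
    ∃ h : X → ℂ, Integrable h ν ∧
      ∀ a : Lp ℂ ∞ ν, ∫ z, a (f z) * g z ∂m = ∫ x, a x * h x ∂ν := by
  have hint : ∀ (a : Lp ℂ ∞ ν) {k : Z → ℂ}, Integrable k m →
      Integrable (fun z => a (f z) * k z) m := fun a k hk => by
    have ha := memLp_indicator_comp (Y := Set.univ) (μ := m) MeasurableSet.univ
      (by simpa using hf) (Lp.memLp a)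
    rw [Set.indicator_univ] at ha
    exact ha.integrable_top_mul hk
  -- the functions that have such an `h` are closed under linear combinations, and `g` is a
  -- combination of the positive and negative parts of its real and imaginary parts
  have hadd : ∀ k l : Z → ℂ, Integrable k m → Integrable l m →
      (∃ h : X → ℂ, Integrable h ν ∧
        ∀ a : Lp ℂ ∞ ν, ∫ z, a (f z) * k z ∂m = ∫ x, a x * h x ∂ν) →
      (∃ h : X → ℂ, Integrable h ν ∧
        ∀ a : Lp ℂ ∞ ν, ∫ z, a (f z) * l z ∂m = ∫ x, a x * h x ∂ν) →
      ∀ c : ℂ, ∃ h : X → ℂ, Integrable h ν ∧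
        ∀ a : Lp ℂ ∞ ν, ∫ z, a (f z) * (k z + c * l z) ∂m = ∫ x, a x * h x ∂ν := by
    rintro k l hk hl ⟨h, hh, hk'⟩ ⟨h', hh', hl'⟩ c
    refine ⟨fun x => h x + c * h' x, hh.add (hh'.const_mul c), fun a => ?_⟩
    have e1 : ∀ z, a (f z) * (k z + c * l z) = a (f z) * k z + c * (a (f z) * l z) :=
      fun z => by ring
    have e2 : ∀ x, a x * (h x + c * h' x) = a x * h x + c * (a x * h' x) := fun x => by ring
    simp only [e1, e2]
    rw [integral_add (hint a hk) ((hint a hl).const_mul c),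
      integral_add ((Lp.memLp a).integrable_top_mul hh)
        (((Lp.memLp a).integrable_top_mul hh').const_mul c),
      integral_const_mul, integral_const_mul, hk', hl']
  have hreal : ∀ k : Z → ℝ, Integrable k m → ∃ h : X → ℂ, Integrable h ν ∧
      ∀ a : Lp ℂ ∞ ν, ∫ z, a (f z) * (k z : ℂ) ∂m = ∫ x, a x * h x ∂ν := by
    intro k hk
    have key := hadd _ _ hk.pos_part.ofReal hk.neg_part.ofReal
      (exists_density_of_nonneg hf hk.pos_part fun _ => le_max_right _ _)
      (exists_density_of_nonneg hf hk.neg_part fun _ => le_max_right _ _) (-1)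
    have e : ∀ z, ((max (k z) 0 : ℝ) : ℂ) + -1 * ((max (-k z) 0 : ℝ) : ℂ) = k z := fun z => by
      have := max_zero_sub_max_neg_zero_eq_self (k z)
      rw [neg_one_mul, ← sub_eq_add_neg, ← Complex.ofReal_sub]
      exact congrArg _ this
    simpa only [Complex.coe_algebraMap, RCLike.ofReal_eq_complex_ofReal, e] using key
  have key := hadd _ _ hg.re.ofReal hg.im.ofReal (hreal _ hg.re) (hreal _ hg.im) Complex.I
  have e : ∀ z, ((RCLike.re (g z) : ℝ) : ℂ) + Complex.I * ((RCLike.im (g z) : ℝ) : ℂ) = g z :=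
    fun z => by rw [mul_comm]; exact Complex.re_add_im (g z)
  simpa only [RCLike.ofReal_eq_complex_ofReal, e] using key

/-- `linftyPullback` is weak-* continuous, as it is the adjoint of a map `L¹(μ) → L¹(ν)`. -/
theorem continuous_linftyPullback [SigmaFinite ν] (hY : MeasurableSet Y)
    (hf : Measure.QuasiMeasurePreserving f (μ.restrict Y) ν) :
    Continuous[weakStarTopology ν, weakStarTopology μ] (linftyPullback hY hf) := by
  refine continuous_iInf_rng.2 fun g => continuous_induced_rng.2 ?_
  obtain ⟨h, hh, heq⟩ := exists_density hf (L1.integrable_coeFn g).restrict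
  refine continuous_iInf_dom (i := hh.toL1 h) ?_
  convert continuous_induced_dom using 1
  funext a
  have h1 : ∀ᵐ x ∂μ, linftyPullback hY hf a x * g x = Y.indicator (fun x => a (f x) * g x) x := by
    filter_upwards [coeFn_linftyPullback hY hf a] with x hx
    rw [hx]
    by_cases h : x ∈ Y <;> simp [h]
  have h2 : ∀ᵐ x ∂ν, a x * hh.toL1 h x = a x * h x := by
    filter_upwards [hh.coeFn_toL1] with x hx
    rw [hx]
  simp only [Function.comp_apply]
  rw [integral_congr_ae h1, integral_indicator hY, heq, integral_congr_ae h2]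

end Pullback

/-! ### Openness from a weak-* continuous extension -/

section Necessity

variable {F : Type u} [Group F] [TopologicalSpace F] [IsTopologicalGroup F] [T2Space F]
  [LocallyCompactSpace F] [SecondCountableTopology F] [MeasurableSpace F] [BorelSpace F]
  {ν : Measure F} [ν.IsHaarMeasure]

/-- The indicator of a compact set `E` is a pointwise limit of elements of `A(F)` that are bounded by
`1` and equal to `1` on `E`: take `s ↦ ν(E V ∩ s V) / ν(V)` for small neighbourhoods `V` of `1`. -/
theorem exists_fourierAlgebra_approx {E : Set F} (hE : IsCompact E) :
    ∃ u : ℕ → F → ℂ, (∀ n, u n ∈ fourierAlgebra ν) ∧ (∀ n, ∀ s ∈ E, u n s = 1) ∧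
      (∀ n s, ‖u n s‖ ≤ 1) ∧ ∀ s ∉ E, ∀ᶠ n in Filter.atTop, u n s = 0 := by
  obtain ⟨B, hB⟩ := (𝓝 (1 : F)).exists_antitone_basis
  obtain ⟨W, hW, hW1⟩ := exists_compact_mem_nhds (1 : F)
  let V : ℕ → Set F := fun n => interior (B n) ∩ interior W
  have hVo : ∀ n, IsOpen (V n) := fun n => isOpen_interior.inter isOpen_interior
  have hV1 : ∀ n, (1 : F) ∈ V n := fun n =>
    ⟨mem_interior_iff_mem_nhds.2 (hB.mem n), mem_interior_iff_mem_nhds.2 hW1⟩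
  have hEVo : ∀ n, IsOpen (E * V n) := fun n => (hVo n).mul_left
  have hVfin : ∀ n, ν (V n) ≠ ∞ := fun n =>
    measure_ne_top_of_subset (Set.inter_subset_right.trans interior_subset) hW.measure_ne_top
  have hEVfin : ∀ n, ν (E * V n) ≠ ∞ := fun n =>
    measure_ne_top_of_subset
      (Set.mul_subset_mul_left (Set.inter_subset_right.trans interior_subset))
      (hE.mul hW).measure_ne_top
  have hVpos : ∀ n, 0 < ν.real (V n) := fun n =>
    ENNReal.toReal_pos ((hVo n).measure_ne_zero ν ⟨1, hV1 n⟩) (hVfin n)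
  have hpre : ∀ n s, ν.real ((fun x => s⁻¹ * x) ⁻¹' V n) = ν.real (V n) := fun n s => by
    rw [measureReal_def, measure_preimage_mul, measureReal_def]
  let u : ℕ → F → ℂ := fun n s =>
    ((ν.real (E * V n ∩ (fun x => s⁻¹ * x) ⁻¹' V n) / ν.real (V n) : ℝ) : ℂ)
  refine ⟨u, fun n => ?_, fun n s hs => ?_, fun n s => ?_, fun s hs => ?_⟩
  · refine ⟨indicatorConstLp 2 (hVo n).measurableSet (hVfin n) ((ν.real (V n))⁻¹ : ℂ),
      indicatorConstLp 2 (hEVo n).measurableSet (hEVfin n) 1, fun s => ?_⟩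
    rw [DomMulAct.mk_smul_indicatorConstLp, L2.inner_indicatorConstLp_indicatorConstLp
      (hEVo n).measurableSet _ (hEVfin n) (by
        rw [measure_preimage_smul]
        exact hVfin n)]
    simp [u, div_eq_mul_inv]
  · have hsub : (fun x => s⁻¹ * x) ⁻¹' V n ⊆ E * V n := fun x hx =>
      ⟨s, hs, s⁻¹ * x, hx, by simp⟩
    simp only [u]
    rw [Set.inter_eq_right.2 hsub, hpre, div_self (hVpos n).ne', Complex.ofReal_one]
  · simp only [u]
    rw [Complex.norm_real, Real.norm_of_nonneg (by positivity), div_le_one (hVpos n), ← hpre n s]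
    exact measureReal_mono Set.inter_subset_right (by rw [measure_preimage_mul]; exact hVfin n)
  · -- if `s v = e w` with `v`, `w` near `1`, then `s v w⁻¹ ∈ E`, which is impossible near `s`
    have hcont : Filter.Tendsto (fun p : F × F => s * p.1 * p.2⁻¹) (𝓝 (1, 1)) (𝓝 s) := by
      have : Continuous fun p : F × F => s * p.1 * p.2⁻¹ := by fun_prop
      simpa using this.tendsto (1, 1)
    have hnhds := hcont (hE.isClosed.isOpen_compl.mem_nhds hs)
    rw [nhds_prod_eq] at hnhds
    obtain ⟨N, hN, hNs⟩ := Filter.mem_prod_same_iff.1 hnhds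
    obtain ⟨n₀, hn₀⟩ := hB.mem_iff.1 hN
    filter_upwards [Filter.eventually_ge_atTop n₀] with n hn
    have hVN : V n ⊆ N :=
      (Set.inter_subset_left.trans interior_subset).trans ((hB.antitone hn).trans hn₀)
    have hempty : E * V n ∩ (fun x => s⁻¹ * x) ⁻¹' V n = ∅ := by
      refine Set.eq_empty_of_forall_notMem ?_
      rintro _ ⟨⟨a, ha, w, hw, rfl⟩, hx⟩
      have := hNs (Set.mk_mem_prod (hVN hx) (hVN hw))
      simp [mul_assoc] at this
      exact this ha
    simp [u, hempty]

/-- Dominated convergence, in the weak-* topology. -/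
theorem tendsto_weakStarTopology_zero {X : Type u} [MeasurableSpace X] {ρ : Measure X}
    {f : ℕ → Lp ℂ ∞ ρ} (hb : ∀ n, ∀ᵐ x ∂ρ, ‖f n x‖ ≤ 1)
    (hlim : ∀ᵐ x ∂ρ, Filter.Tendsto (fun n => f n x) Filter.atTop (𝓝 0)) :
    Filter.Tendsto f Filter.atTop (@nhds _ (weakStarTopology ρ) 0) := by
  rw [nhds_iInf, Filter.tendsto_iInf]
  intro h
  rw [nhds_induced, Filter.tendsto_comap_iff]
  have hzero : ∀ᵐ x ∂ρ, (0 : Lp ℂ ∞ ρ) x * h x = 0 := by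
    filter_upwards [Lp.coeFn_zero ℂ ∞ ρ] with x hx
    rw [hx, Pi.zero_apply, zero_mul]
  rw [integral_congr_ae hzero]
  have hint := L1.integrable_coeFn h
  refine tendsto_integral_of_dominated_convergence (fun x => ‖h x‖)
    (fun n => (Lp.aestronglyMeasurable _).mul hint.1) hint.norm (fun n => ?_) ?_
  · filter_upwards [hb n] with x hx
    rw [norm_mul]
    exact mul_le_of_le_one_left (norm_nonneg _) hx
  · filter_upwards [hlim] with x hx
    simpa using hx.mul_const (h x)

variable {G : Type v} [Group G] [TopologicalSpace G]
  [MeasurableSpace G] [BorelSpace G] {μ : Measure G} [μ.IsHaarMeasure] {Y : Set G} {α : Y → F}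

/-- If `φ_α` has a weak-* continuous extension, a compact set with null image is null: the functions
`u n` of `exists_fourierAlgebra_approx` for the image tend to `0` weak-*, but `φ_α (u n) = 1` on the
compact set. -/
theorem measure_eq_zero_of_measure_image_eq_zero [T2Space G] {Φ : Lp ℂ ∞ ν →L[ℂ] Lp ℂ ∞ μ}
    (hΦ : Continuous[weakStarTopology ν, weakStarTopology μ] Φ) (hext : ExtendsPhi ν μ α Φ)
    (hα : Continuous α) {B : Set G} (hB : IsCompact B) (hBY : B ⊆ Y)
    (h0 : ν (α '' ((↑) ⁻¹' B)) = 0) : μ B = 0 := by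
  have hBY' : IsCompact ((↑) ⁻¹' B : Set Y) :=
    (IsInducing.subtypeVal.isCompact_preimage_iff (by simpa using hBY)).2 hB
  obtain ⟨u, huA, hu1, hub, hu0⟩ := exists_fourierAlgebra_approx (ν := ν) (hBY'.image hα)
  choose f hfu hΦf using fun n => hext (u n) (huA n)
  have hf0 : Filter.Tendsto f Filter.atTop (@nhds _ (weakStarTopology ν) 0) := by
    refine tendsto_weakStarTopology_zero (fun n => ?_) ?_
    · filter_upwards [hfu n] with x hx
      rw [hx]
      exact hub n x
    · filter_upwards [ae_all_iff.2 hfu, measure_eq_zero_iff_ae_notMem.1 h0] with x hx hxE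
      simp only [hx]
      exact tendsto_const_nhds.congr' ((hu0 x hxE).mono fun n hn => hn.symm)
  let g : Lp ℂ 1 μ := indicatorConstLp 1 hB.measurableSet hB.measure_ne_top 1
  have hg : Continuous[weakStarTopology μ, _] fun k : Lp ℂ ∞ μ => ∫ x, k x * g x ∂μ :=
    continuous_iInf_dom (i := g) continuous_induced_dom
  have hgΦ : Continuous[weakStarTopology ν, _] fun k : Lp ℂ ∞ ν => ∫ x, Φ k x * g x ∂μ :=
    @Continuous.comp _ _ _ (weakStarTopology ν) (weakStarTopology μ) _ _ _ hg hΦ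
  have hlim : Filter.Tendsto (fun n => ∫ x, Φ (f n) x * g x ∂μ) Filter.atTop
      (𝓝 (∫ x, Φ 0 x * g x ∂μ)) :=
    (@Continuous.tendsto _ _ (weakStarTopology ν) _ _ hgΦ 0).comp hf0
  have hconst : ∀ n, ∫ x, Φ (f n) x * g x ∂μ = μ.real B := by
    intro n
    have : ∀ᵐ x ∂μ, Φ (f n) x * g x = B.indicator (fun _ => (1 : ℂ)) x := by
      filter_upwards [hΦf n, (indicatorConstLp_coeFn : g =ᵐ[μ] _)] with x h1 h2
      rw [h1, h2]
      by_cases hx : x ∈ B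
      · have h3 : u n (α ⟨x, hBY hx⟩) = 1 := hu1 n _ ⟨⟨x, hBY hx⟩, hx, rfl⟩
        simp [phiMap, hBY hx, hx, h3]
      · simp [hx]
    rw [integral_congr_ae this, integral_indicator_const _ hB.measurableSet]
    simp
  have hzero : ∫ x, Φ 0 x * g x ∂μ = 0 := by
    rw [map_zero]
    refine integral_eq_zero_of_ae ?_
    filter_upwards [Lp.coeFn_zero ℂ ∞ μ] with x hx
    rw [hx, Pi.zero_apply, zero_mul]
  have heq : ((μ.real B : ℝ) : ℂ) = 0 := by
    simp only [hconst, hzero] at hlim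
    exact tendsto_nhds_unique tendsto_const_nhds hlim
  exact (measureReal_eq_zero_iff hB.measure_ne_top).1 (Complex.ofReal_eq_zero.1 heq)

/-- If compact sets with null image are null, `α` is open. Around `t`, the map is
`t p ↦ e (θ (t₀ t) θ p)`; for a compact neighbourhood `P` of `1` the set `Q = θ(P)` has positive
measure, so by Steinhaus' theorem `Q / Q = θ(P / P)` is a neighbourhood of `1`. -/
theorem IsMixedPiecewiseAffine.isOpenMap [IsTopologicalGroup G] [LocallyCompactSpace G]
    (hα : IsMixedPiecewiseAffine α)
    (h0 : ∀ B : Set G, IsCompact B → B ⊆ Y → ν (α '' ((↑) ⁻¹' B)) = 0 → μ B = 0) :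
    IsOpenMap α := by
  rw [isOpenMap_iff_nhds_le]
  rintro ⟨t, ht⟩ S hS
  obtain ⟨U, hU, hUS⟩ := mem_nhds_subtype _ _ _ |>.1 (Filter.mem_map.1 hS)
  obtain ⟨m, A, hY, h⟩ := hα.exists_cover
  obtain ⟨i, hi⟩ := Set.mem_iUnion.1 (hY ▸ ht)
  obtain ⟨hA, K, θ, t₀, e, hK, hθ, he, hform⟩ := h i
  have hAY : A i ⊆ Y := hY ▸ Set.subset_iUnion A i
  obtain ⟨hk₀, hαt⟩ := hform t ht hi
  have hcont : Filter.Tendsto (fun p : G × G => t * (p.1 * p.2⁻¹)) (𝓝 (1, 1)) (𝓝 t) := by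
    have : Continuous fun p : G × G => t * (p.1 * p.2⁻¹) := by fun_prop
    simpa using this.tendsto (1, 1)
  have hnhds := hcont (Filter.inter_mem hU (hA.mem_nhds hi))
  rw [nhds_prod_eq] at hnhds
  obtain ⟨N, hN, hNs⟩ := Filter.mem_prod_same_iff.1 hnhds
  obtain ⟨P, hP1, hPsub, hP⟩ :=
    local_compact_nhds (Filter.inter_mem hN (hK.mem_nhds K.one_mem))
  have hUA : ∀ p ∈ P, ∀ q ∈ P, t * (p * q⁻¹) ∈ U ∩ A i := fun p hp q hq =>
    hNs (Set.mk_mem_prod (hPsub hp).1 (hPsub hq).1)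
  have h1P : (1 : G) ∈ P := mem_of_mem_nhds hP1
  have hPA : ∀ p ∈ P, t * p ∈ A i := fun p hp => by simpa using (hUA p hp 1 h1P).2
  -- on `t K ∩ A i` the map is `t p ↦ e (θ (t₀ t) θ p)`
  have hval : ∀ p : K, ∀ hp : t * (p : G) ∈ A i,
      α ⟨t * p, hAY hp⟩ = e (θ ⟨t₀ * t, hk₀⟩ * θ p) := by
    intro p hp
    obtain ⟨hk, hv⟩ := hform (t * p) (hAY hp) hp
    rw [hv, ← map_mul]
    congr 2
    ext
    simp [mul_assoc]
  set Q : Set F := θ '' ((↑) ⁻¹' P) with hQ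
  have hQc : IsCompact Q := ((IsInducing.subtypeVal.isCompact_preimage_iff
    (by simpa using hPsub.trans Set.inter_subset_right)).2 hP).image hθ
  have hQpos : 0 < ν Q := by
    rw [pos_iff_ne_zero]
    intro hQ0
    have hB : IsCompact ((fun p => t * p) '' P) := hP.image (continuous_const_mul t)
    have hμ : μ ((fun p => t * p) '' P) = 0 := by
      refine h0 _ hB ?_ ?_
      · rintro _ ⟨p, hp, rfl⟩
        exact hAY (hPA p hp)
      · have hQ0' : ν (e '' ((fun x => (θ ⟨t₀ * t, hk₀⟩)⁻¹ * x) ⁻¹' Q)) = 0 := by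
          rw [he.measure_image_eq_zero_iff, measure_preimage_mul, hQ0]
        refine measure_mono_null ?_ hQ0'
        rintro _ ⟨⟨_, _⟩, ⟨p, hp, rfl⟩, rfl⟩
        have hpK : p ∈ K := (hPsub hp).2
        rw [hval ⟨p, hpK⟩ (hPA p hp)]
        exact Set.mem_image_of_mem _ ⟨⟨p, hpK⟩, hp, by simp⟩
    have hPμ : μ P = 0 := by
      rw [Set.image_mul_left, measure_preimage_mul] at hμ
      exact hμ
    exact (Measure.measure_pos_of_mem_nhds μ hP1).ne' hPμ
  have hQQ := Measure.div_mem_nhds_one_of_haar_pos ν Q hQc.measurableSet hQpos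
  have hnb : e '' ((fun x => θ ⟨t₀ * t, hk₀⟩ * x) '' (Q / Q)) ∈ 𝓝 (α ⟨t, ht⟩) := by
    rw [hαt]
    refine e.isOpenMap.image_mem_nhds ?_
    simpa using (isOpenMap_mul_left (θ ⟨t₀ * t, hk₀⟩)).image_mem_nhds hQQ
  refine Filter.mem_of_superset hnb ?_
  rintro _ ⟨_, ⟨_, ⟨_, ⟨p, hp, rfl⟩, _, ⟨q, hq, rfl⟩, rfl⟩, rfl⟩, rfl⟩
  have hmem := hUA p hp q hq
  have hv := hval (p * q⁻¹) (by simpa using hmem.2)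
  have hS' : (⟨t * ((p * q⁻¹ : K) : G), hAY (by simpa using hmem.2)⟩ : Y) ∈ α ⁻¹' S :=
    hUS (by simpa using hmem.1)
  rw [Set.mem_preimage, hv] at hS'
  simpa [div_eq_mul_inv] using hS'

end Necessity

/-! ### The extension for an open map -/

section Sufficiency

variable {F : Type u} [Group F] [TopologicalSpace F] [IsTopologicalGroup F] [T2Space F]
  [LocallyCompactSpace F] [SecondCountableTopology F] [MeasurableSpace F] [BorelSpace F]
  {ν : Measure F} [ν.IsHaarMeasure] {G : Type v} [Group G] [TopologicalSpace G]
  [IsTopologicalGroup G] [LocallyCompactSpace G] [SecondCountableTopology G] [MeasurableSpace G]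
  [BorelSpace G] {μ : Measure G} [μ.IsHaarMeasure] {Y : Set G} {α : Y → F}

theorem fourierAlgebra.memLp_top {φ : F → ℂ} (hφ : φ ∈ fourierAlgebra ν) : MemLp φ ∞ ν := by
  obtain ⟨ξ, η, h⟩ := mem_fourierAlgebra_iff.1 hφ
  have hc : Continuous φ := by
    rw [show φ = fun s => inner ℂ η (leftRegularRep ν s ξ) from funext h]
    exact continuous_const.inner (continuous_leftRegularRep ν ξ)
  refine memLp_top_of_bound hc.aestronglyMeasurable (‖η‖ * ‖ξ‖)
    (Filter.Eventually.of_forall fun s => ?_)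
  rw [h, ← norm_leftRegularRep ν s ξ]
  exact norm_inner_le_norm _ _

/-- For open `α` the extension is `a ↦ χ_Y · (a ∘ α)`. -/
theorem IsMixedPiecewiseAffine.exists_extension (hY : IsClopen Y) (hα : IsMixedPiecewiseAffine α)
    (ho : IsOpenMap α) :
    ∃ Φ : Lp ℂ ∞ ν →L[ℂ] Lp ℂ ∞ μ, IsMultiplicative Φ ∧
      Continuous[weakStarTopology ν, weakStarTopology μ] Φ ∧ ExtendsPhi ν μ α Φ := by
  classical
  -- the value of the extension of `α` off `Y` is irrelevant
  let f : G → F := fun t => if h : t ∈ Y then α ⟨t, h⟩ else 1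
  have hfm : Measurable f := Measurable.dite (s := Y) (f := α) (g := fun _ => 1)
    hα.continuous.measurable measurable_const hY.isOpen.measurableSet
  have hf : Measure.QuasiMeasurePreserving f (μ.restrict Y) ν := by
    refine ⟨hfm, Measure.AbsolutelyContinuous.mk fun N hN hN0 => ?_⟩
    rw [Measure.map_apply hfm hN, Measure.restrict_apply (hfm hN)]
    refine measure_mono_null ?_ (hα.measure_preimage_eq_zero (μ := μ) ho hN hN0)
    rintro t ⟨ht, htY⟩
    exact ⟨htY, by simpa [f, htY] using ht⟩
  have hYm := hY.isOpen.measurableSet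
  refine ⟨linftyPullback hYm hf, isMultiplicative_linftyPullback hYm hf,
    continuous_linftyPullback hYm hf, fun φ hφ => ?_⟩
  have hφ' := (fourierAlgebra.memLp_top hφ).coeFn_toLp
  refine ⟨(fourierAlgebra.memLp_top hφ).toLp φ, hφ', ?_⟩
  refine (coeFn_linftyPullback hYm hf _).trans ((indicator_comp_ae_eq hYm hf hφ').trans ?_)
  refine Filter.EventuallyEq.of_eq (funext fun t => ?_)
  by_cases h : t ∈ Y <;> simp [phiMap, f, h]

end Sufficiency

/-! ### The equivalence -/

theorem theorem5555 {F : Type u} {G : Type v}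
    [Group F] [TopologicalSpace F] [IsTopologicalGroup F] [T2Space F] [LocallyCompactSpace F]
    [SecondCountableTopology F] [MeasurableSpace F] [BorelSpace F]
    [Group G] [TopologicalSpace G] [IsTopologicalGroup G] [T2Space G] [LocallyCompactSpace G]
    [SecondCountableTopology G] [MeasurableSpace G] [BorelSpace G]
    (ν : Measure F) [ν.IsHaarMeasure] (μ : Measure G) [μ.IsHaarMeasure]
    (Y : Set G) (hY : IsClopen Y) (α : Y → F) (hα : IsMixedPiecewiseAffine α) :
    (∀ φ ∈ fourierAlgebra ν, phiMap α φ ∈ fourierStieltjesAlgebra.{v, max u v} G) ∧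
    ((∃ Φ : Lp ℂ ∞ ν →L[ℂ] Lp ℂ ∞ μ,
        IsMultiplicative Φ ∧
        Continuous[weakStarTopology ν, weakStarTopology μ] Φ ∧
        ExtendsPhi ν μ α Φ) ↔
      IsOpenMap α) := by
  refine ⟨fun φ hφ => phiMap_mem_fourierStieltjesAlgebra hα hφ, ?_, hα.exists_extension hY⟩
  rintro ⟨Φ, -, hΦ, hext⟩
  exact hα.isOpenMap (ν := ν) (μ := μ) fun B hB hBY h0 =>
    measure_eq_zero_of_measure_image_eq_zero hΦ hext hα.continuous hB hBY h0
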